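/- All graphs are finite, simple, undirected and have at least one vertex. For a graph $G$ and $X\subseteq V(G)$, a connected component $C$ of $G-X$ is a \emph{full component} of $X$ if $N_G(C)=X$, where $N_G(C)$ is the set of vertices outside $C$ with a neighbor in $C$; the set $X$ is a \emph{minimal separator} of $G$ if it has at least two full components. A graph is \emph{chordal} if it has no induced cycle on four or more vertices. A \emph{minimal triangulation} of $G$ is a chordal graph $H$ with $V(H)=V(G)$ and $E(G)\subseteq E(H)$ such that no chordal graph $H'$ with $V(H')=V(G)$ satisfies $E(G)\subseteq E(H')\subsetneq E(H)$. A set $\Omega\subseteq V(G)$ is a \emph{potential maximal clique} of $G$ if it is an inclusion-wise maximal clique of some minimal triangulation of $G$. **Theorem.** Let $G$ be an $n$-vertex graph that contains no induced path on $6$ vertices, and let $k$ be the clique number of $G$, that is, the maximum number of pairwise adjacent vertices. Then $G$ has at most $(2n)^{k+1}$ minimal separators and at most $2^{2k+2}n^{2k+3}$ potential maximal cliques. -/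

import Mathlib

namespace SimpleGraph

variable {V : Type*}

/-- The open neighbourhood `N_G(S)` of a vertex set: the vertices outside `S` with a neighbour
in `S`. -/
def openNbhd (G : SimpleGraph V) (S : Set V) : Set V :=
  {v | v ∉ S ∧ ∃ u ∈ S, G.Adj u v}

/-- A connected component `C` of `G - X` is a full component of `X` if `N_G(C) = X`. -/
def IsFullComponent (G : SimpleGraph V) (X : Set V)
    (C : (G.induce Xᶜ).ConnectedComponent) : Prop :=
  G.openNbhd (Subtype.val '' C.supp) = X

/-- A minimal separator is a vertex set with at least two full components. -/
def IsMinimalSeparator (G : SimpleGraph V) (X : Set V) : Prop :=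
  ∃ A B : (G.induce Xᶜ).ConnectedComponent,
    A ≠ B ∧ G.IsFullComponent X A ∧ G.IsFullComponent X B

/-- A graph is chordal if it has no induced cycle on four or more vertices. -/
def IsChordal (G : SimpleGraph V) : Prop :=
  ∀ m : ℕ, 4 ≤ m → ¬ (cycleGraph m).IsIndContained G

/-- `H` is a triangulation of `G` if it is a chordal graph on the same vertex set that contains
all edges of `G`. -/
def IsTriangulation (G H : SimpleGraph V) : Prop :=
  G ≤ H ∧ H.IsChordal

/-- A minimal triangulation of `G` is a triangulation whose edge set is inclusion-wise minimal. -/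
def IsMinimalTriangulation (G H : SimpleGraph V) : Prop :=
  Minimal G.IsTriangulation H

/-- A potential maximal clique of `G` is a vertex set that is an inclusion-wise maximal clique of
some minimal triangulation of `G`. -/
def IsPotentialMaximalClique (G : SimpleGraph V) (Ω : Set V) : Prop :=
  ∃ H : SimpleGraph V, G.IsMinimalTriangulation H ∧ Maximal H.IsClique Ω

end SimpleGraph

/-! Separators. Let `A` and `B` be two full components of `X`. Some `k` vertices of `A`, with
repetition, dominate every vertex of `X` from which no induced `P₄` leads into `A`. An undominated
`v ∈ X` starts such a `P₄`; if `v` saw only part of `B`, an edge of `B` leaving the neighbourhood of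
`v` would extend it to an induced `P₆`. So `v` is complete to `B`. Fix the dominating tuple and a
vertex `b ∈ B`. The undominated part `T` of `X` lies in the undominated closed neighbourhood `Z` of
`b` and is complete to `Z \ T ⊆ B`. Hence `T` is a union of components of the complement of `G[Z]`.
There are at most `k` of these, as representatives form a clique, so `T` has at most `2 ^ k` values.
Tuple, `b` and `T` determine `B`, and `X` is its neighbourhood (`IsMinSepIn.exists_eq_openNbhd`).

Potential maximal cliques. They satisfy the two conditions of `IsCliquishIn`
(`IsPotentialMaximalClique.isCliquishIn`). When a vertex `a` is deleted, such a set either survives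
without `a` or is built from `a` and at most two minimal separators. With at most `s` separators in
every induced subgraph, each deletion costs at most `s + s * s` sets, whence the bound `1 + n * (s +
s * s)`. -/

namespace SimpleGraph

open Relation

variable {V : Type*}

/-! ### Components of induced subgraphs and of their complements -/

/-- The vertex set of the connected component of `x` in the subgraph of `G` induced on `U`
(it is `{x}` if `x ∉ U`). -/
def compIn (G : SimpleGraph V) (U : Set V) (x : V) : Set V :=
  {y | ReflTransGen (fun a b => G.Adj a b ∧ a ∈ U ∧ b ∈ U) x y}

section compIn

variable {G H : SimpleGraph V} {U U' E : Set V} {x y z : V}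

theorem self_mem_compIn : x ∈ G.compIn U x := ReflTransGen.refl

/-- The tool for bounding components from above: no edge of `G[U]` leaves `E`. -/
theorem compIn_subset_of_closed (hx : x ∈ E)
    (hE : ∀ y ∈ E, y ∈ U → ∀ z ∈ U, G.Adj y z → z ∈ E) : G.compIn U x ⊆ E := by
  intro y hy
  induction hy with
  | refl => exact hx
  | tail _ h ih => exact hE _ ih h.2.1 _ h.2.2 h.1

theorem compIn_subset (hx : x ∈ U) : G.compIn U x ⊆ U :=
  compIn_subset_of_closed hx fun _ _ _ _ hz _ => hz

theorem mem_compIn_of_adj (hy : y ∈ G.compIn U x) (hyU : y ∈ U) (hz : z ∈ U) (h : G.Adj y z) :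
    z ∈ G.compIn U x :=
  ReflTransGen.tail hy ⟨h, hyU, hz⟩

theorem mem_compIn_symm (hy : y ∈ G.compIn U x) : x ∈ G.compIn U y := by
  induction hy with
  | refl => exact self_mem_compIn
  | tail _ h ih => exact ReflTransGen.head ⟨h.1.symm, h.2.2, h.2.1⟩ ih

theorem mem_compIn_trans (hy : y ∈ G.compIn U x) (hz : z ∈ G.compIn U y) : z ∈ G.compIn U x :=
  ReflTransGen.trans hy hz

theorem compIn_eq (hy : y ∈ G.compIn U x) : G.compIn U y = G.compIn U x :=
  Set.Subset.antisymm (fun _ h => mem_compIn_trans hy h)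
    fun _ h => mem_compIn_trans (mem_compIn_symm hy) h

theorem compIn_mono (hU : U ⊆ U') : G.compIn U x ⊆ G.compIn U' x := fun _ hy => by
  induction hy with
  | refl => exact self_mem_compIn
  | tail _ h ih => exact mem_compIn_of_adj ih (hU h.2.1) (hU h.2.2) h.1

theorem compIn_mono_graph (hG : G ≤ H) : G.compIn U x ⊆ H.compIn U x := fun _ hy => by
  induction hy with
  | refl => exact self_mem_compIn
  | tail _ h ih => exact mem_compIn_of_adj ih h.2.1 h.2.2 (hG h.1)

/-- A component of `G[U]` that survives in `U'` is connected in `G[U']`. -/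
theorem compIn_subset_compIn (hU : G.compIn U x ⊆ U') : G.compIn U x ⊆ G.compIn U' x := by
  intro y hy
  induction hy with
  | refl => exact self_mem_compIn
  | tail h1 h ih => exact mem_compIn_of_adj ih (hU h1) (hU (ReflTransGen.tail h1 h)) h.1

/-- Every two vertices of a component are connected inside it. -/
theorem compIn_connected (hy : y ∈ G.compIn U x) (hz : z ∈ G.compIn U x) :
    z ∈ G.compIn (G.compIn U x) y := by
  have h := compIn_subset_compIn (G := G) (U := U) (x := x) (U' := G.compIn U x) subset_rfl
  exact mem_compIn_trans (mem_compIn_symm (h hy)) (h hz)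

/-- A property that changes within a component changes along one of its edges. -/
theorem exists_adj_switch (P : V → Prop) (hx : P x) (hy : y ∈ G.compIn U x) (hPy : ¬ P y) :
    ∃ a ∈ G.compIn U x, ∃ b ∈ G.compIn U x, a ∈ U ∧ b ∈ U ∧ G.Adj a b ∧ P a ∧ ¬ P b := by
  by_contra hcon
  push Not at hcon
  have : G.compIn U x ⊆ {z | z ∈ G.compIn U x ∧ P z} :=
    compIn_subset_of_closed ⟨self_mem_compIn, hx⟩ fun a ha haU b hb hab =>
      ⟨mem_compIn_of_adj ha.1 haU hb hab,
        hcon a ha.1 b (mem_compIn_of_adj ha.1 haU hb hab) haU hb hab ha.2⟩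
  exact hPy (this hy).2

theorem compIn_subset_sdiff_singleton (hx : x ∈ U) (hy : y ∉ G.compIn U x) :
    G.compIn U x ⊆ G.compIn (U \ {y}) x :=
  compIn_subset_compIn fun _ hz => ⟨compIn_subset hx hz, fun h => hy (h ▸ hz)⟩

theorem mem_compIn_iff_reachable (hx : x ∈ U) :
    y ∈ G.compIn U x ↔ ∃ hy : y ∈ U, (G.induce U).Reachable ⟨x, hx⟩ ⟨y, hy⟩ := by
  constructor
  · intro h
    induction h with
    | refl => exact ⟨hx, Reachable.refl _⟩
    | tail _ h ih =>
      obtain ⟨hb, hr⟩ := ih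
      exact ⟨h.2.2, hr.trans (Adj.reachable (by simpa using h.1))⟩
  · rintro ⟨hy, ⟨p⟩⟩
    have key : ∀ {a b : U} (_ : (G.induce U).Walk a b), (b : V) ∈ G.compIn U a := by
      intro a b p
      induction p with
      | nil => exact self_mem_compIn
      | cons h _ ih =>
        exact mem_compIn_trans (mem_compIn_of_adj self_mem_compIn (Subtype.coe_prop _)
          (Subtype.coe_prop _) (by simpa using h)) ih
    exact key p

/-- The components of the complement of `G[Z]` have a transversal, which is a clique of `G`. -/
theorem exists_clique_transversal (G : SimpleGraph V) (Z : Set V) :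
    ∃ R ⊆ Z, G.IsClique R ∧ ∀ z ∈ Z, ∃ r ∈ R, z ∈ Gᶜ.compIn Z r := by
  classical
  -- The representative depends only on the component as a set, so equal components get equal
  -- representatives; `z` is a default for the empty set.
  let rep : Set V → Z → V := fun C z => if h : C.Nonempty then h.some else z
  have hrep : ∀ z : Z, rep (Gᶜ.compIn Z z) z ∈ Gᶜ.compIn Z z := by
    intro z
    have h : (Gᶜ.compIn Z (z : V)).Nonempty := ⟨z, self_mem_compIn⟩
    simp only [rep, dif_pos h]
    exact h.some_mem
  have huniq : ∀ z z' : Z, rep (Gᶜ.compIn Z z') z' ∈ Gᶜ.compIn Z (rep (Gᶜ.compIn Z z) z) →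
      rep (Gᶜ.compIn Z z) z = rep (Gᶜ.compIn Z z') z' := by
    intro z z' h
    have e : Gᶜ.compIn Z (z : V) = Gᶜ.compIn Z (z' : V) := by
      rw [← compIn_eq (hrep z), ← compIn_eq (hrep z'), compIn_eq h]
    have h2 : (Gᶜ.compIn Z (z' : V)).Nonempty := ⟨z', self_mem_compIn⟩
    simp only [rep, dif_pos h2, e]
  refine ⟨Set.range fun z : Z => rep (Gᶜ.compIn Z z) z, ?_, ?_, ?_⟩
  · rintro _ ⟨z, rfl⟩
    exact compIn_subset z.2 (hrep z)
  · rintro _ ⟨z, rfl⟩ _ ⟨z', rfl⟩ hne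
    by_contra hadj
    exact hne (huniq z z' (mem_compIn_of_adj self_mem_compIn (compIn_subset z.2 (hrep z))
      (compIn_subset z'.2 (hrep z')) ((compl_adj _ _ _).2 ⟨hne, hadj⟩)))
  · intro z hz
    exact ⟨_, ⟨⟨z, hz⟩, rfl⟩, mem_compIn_symm (hrep ⟨z, hz⟩)⟩

end compIn

/-! ### Modules and dominating cliques -/

/-- No induced path on four vertices starts in `v` and has its other vertices in `A`. -/
def NoPathFourInto (G : SimpleGraph V) (v : V) (A : Set V) : Prop :=
  ∀ x ∈ A, ∀ y ∈ A, ∀ z ∈ A, G.Adj v x → G.Adj x y → G.Adj y z → ¬ G.Adj v y → ¬ G.Adj v z →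
    G.Adj x z

/-- `M` is a module of the induced subgraph `G[A]`. -/
def IsModuleIn (G : SimpleGraph V) (A M : Set V) : Prop :=
  M ⊆ A ∧ ∀ z ∈ A, z ∉ M → ∀ x ∈ M, ∀ y ∈ M, G.Adj z x → G.Adj z y

theorem IsModuleIn.union {G : SimpleGraph V} {A M N : Set V} {p : V} (hM : G.IsModuleIn A M)
    (hN : G.IsModuleIn A N) (hpM : p ∈ M) (hpN : p ∈ N) : G.IsModuleIn A (M ∪ N) := by
  refine ⟨Set.union_subset hM.1 hN.1, ?_⟩
  intro z hz hzn x hx y hy hzx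
  have hzM : z ∉ M := fun h => hzn (Or.inl h)
  have hzN : z ∉ N := fun h => hzn (Or.inr h)
  have hp : G.Adj z p := by
    rcases hx with hx | hx
    · exact hM.2 z hz hzM x hx p hpM hzx
    · exact hN.2 z hz hzN x hx p hpN hzx
  rcases hy with hy | hy
  · exact hM.2 z hz hzM p hpM y hy hp
  · exact hN.2 z hz hzN p hpN y hy hp

/-- Two intersecting proper modules do not cover a connected and co-connected graph. -/
theorem IsModuleIn.union_ne {G : SimpleGraph V} {A M N : Set V} {p : V}
    (hA : ∀ x ∈ A, ∀ y ∈ A, y ∈ G.compIn A x) (hA' : ∀ x ∈ A, ∀ y ∈ A, y ∈ Gᶜ.compIn A x)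
    (hM : G.IsModuleIn A M) (hN : G.IsModuleIn A N) (hpM : p ∈ M) (hpN : p ∈ N)
    (hMA : M ≠ A) (hNA : N ≠ A) : M ∪ N ≠ A := by
  intro hU
  obtain ⟨x, hxA, hxN⟩ := Set.exists_of_ssubset (hN.1.ssubset_of_ne hNA)
  obtain ⟨y, hyA, hyM⟩ := Set.exists_of_ssubset (hM.1.ssubset_of_ne hMA)
  have hsub : ∀ z ∈ A, z ∉ N → z ∈ M := fun z hz h => (hU ▸ hz : z ∈ M ∪ N).resolve_right h
  have hsub' : ∀ z ∈ A, z ∉ M → z ∈ N := fun z hz h => (hU ▸ hz : z ∈ M ∪ N).resolve_left h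
  have hyN := hsub' y hyA hyM
  -- An edge `ab` and a nonedge `cd` both leave `N`. Adjacency passes from `ab` to `by` (module
  -- `N`), to `yd` (module `M`), to `cd` (module `N`).
  obtain ⟨a, -, b, -, haA, hbA, hab, haN, hbN⟩ :=
    exists_adj_switch (fun z => z ∈ N) hpN (hA p (hM.1 hpM) x hxA) hxN
  obtain ⟨c, -, d, -, hcA, hdA, hcd, hcN, hdN⟩ :=
    exists_adj_switch (fun z => z ∈ N) hpN (hA' p (hM.1 hpM) x hxA) hxN
  rw [compl_adj] at hcd
  have hb : G.Adj b y := hN.2 b hbA hbN a haN y hyN hab.symm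
  have hd : G.Adj y d := hM.2 y hyA hyM b (hsub b hbA hbN) d (hsub d hdA hdN) hb.symm
  exact hcd.2 (hN.2 d hdA hdN y hyN c hcN hd.symm).symm

/-- In a connected and co-connected graph on at least two vertices some edge is contained in no
proper module. -/
theorem exists_adj_not_mem_module [Finite V] {G : SimpleGraph V} {A : Set V}
    (hA : ∀ x ∈ A, ∀ y ∈ A, y ∈ G.compIn A x) (hA' : ∀ x ∈ A, ∀ y ∈ A, y ∈ Gᶜ.compIn A x)
    (hne : A.Nontrivial) :
    ∃ p ∈ A, ∃ q ∈ A, G.Adj p q ∧ ∀ D, G.IsModuleIn A D → D ≠ A → p ∈ D → q ∉ D := by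
  obtain ⟨a, ha, b, hb, hab⟩ := hne
  have h0 : G.IsModuleIn A {a} ∧ ({a} : Set V) ≠ A := by
    refine ⟨⟨by simpa using ha, ?_⟩, ?_⟩
    · rintro z - - x rfl y rfl h
      exact h
    · rintro h
      rw [← h] at hb
      exact hab hb.symm
  obtain ⟨M, haM, hM⟩ := (Set.toFinite {M | G.IsModuleIn A M ∧ M ≠ A}).exists_le_maximal h0
  have haM : a ∈ M := haM rfl
  obtain ⟨c, hcA, hcM⟩ := Set.exists_of_ssubset (hM.prop.1.1.ssubset_of_ne hM.prop.2)
  -- Any edge leaving a maximal proper module `M` works: a proper module containing both ends could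
  -- be united with `M`.
  obtain ⟨p, -, q, -, hpA, hqA, hpq, hpM, hqM⟩ :=
    exists_adj_switch (fun z => z ∈ M) haM (hA a ha c hcA) hcM
  refine ⟨p, hpA, q, hqA, hpq, fun D hD hDA hpD hqD => ?_⟩
  have hne := hM.prop.1.union_ne hA hA' hD hpM hpD hM.prop.2 hDA
  exact hqM (hM.le_of_ge ⟨hM.prop.1.union hD hpM hpD, hne⟩ Set.subset_union_left (Or.inr hqD))

/-- Tuples with repetition make the choices of dominating set countable as `n ^ k`; nonemptiness
supplies the value for the surplus indices. -/
theorem exists_fin_enumeration {R : Set V} {k : ℕ} (hR : R.Finite) (hne : R.Nonempty)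
    (hk : R.ncard ≤ k) : ∃ p : Fin k → V, Set.range p = R := by
  have := hR.to_subtype
  have := hne.to_subtype
  have e := Finite.equivFin R
  rw [Nat.card_coe_set_eq] at e
  let f : R ↪ Fin k := e.toEmbedding.trans (Fin.castLEEmb hk)
  refine ⟨fun i => (Function.invFun f i : R), ?_⟩
  rw [show (fun i => ((Function.invFun f i : R) : V)) = Subtype.val ∘ Function.invFun f from rfl,
    (Function.invFun_surjective f.injective).range_comp, Subtype.range_coe]

theorem ncard_le_of_isClique [Finite V] {G : SimpleGraph V} {k : ℕ} (hG : G.CliqueFree (k + 1))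
    {R : Set V} (hR : G.IsClique R) : R.ncard ≤ k := by
  by_contra! h
  have hfin := R.toFinite
  obtain ⟨t, htR, ht⟩ := Finset.exists_subset_card_eq
    (s := hfin.toFinset) (n := k + 1) (by rwa [← Set.ncard_eq_toFinset_card R hfin])
  exact hG t ⟨hR.subset fun x hx => by simpa using htR hx, ht⟩

/-- In a connected set `A` of a graph of clique number at most `k`, some `k` vertices dominate all
neighbours of `A` from which no induced path on four vertices leads into `A`. -/
theorem exists_dominating [Finite V] {G : SimpleGraph V} {k : ℕ} (hk : 1 ≤ k)
    (hG : G.CliqueFree (k + 1)) {A : Set V} (hne : A.Nonempty)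
    (hA : ∀ x ∈ A, ∀ y ∈ A, y ∈ G.compIn A x) :
    ∃ p : Fin k → V, (∀ i, p i ∈ A) ∧
      ∀ v, (∃ y ∈ A, G.Adj v y) → G.NoPathFourInto v A → ∃ i, G.Adj v (p i) := by
  suffices h : ∃ R ⊆ A, R.Nonempty ∧ R.ncard ≤ k ∧
      ∀ v, (∃ y ∈ A, G.Adj v y) → G.NoPathFourInto v A → ∃ r ∈ R, G.Adj v r by
    obtain ⟨R, hRA, hRne, hRk, hR⟩ := h
    obtain ⟨p, rfl⟩ := exists_fin_enumeration R.toFinite hRne hRk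
    refine ⟨p, fun i => hRA ⟨i, rfl⟩, fun v hv hv' => ?_⟩
    obtain ⟨_, ⟨i, rfl⟩, hi⟩ := hR v hv hv'
    exact ⟨i, hi⟩
  by_cases hco : ∀ x ∈ A, ∀ y ∈ A, y ∈ Gᶜ.compIn A x
  · by_cases hnt : A.Nontrivial
    · obtain ⟨p, hp, q, hq, hpq, hmod⟩ := exists_adj_not_mem_module hA hco hnt
      refine ⟨{p, q}, by rintro x (rfl | rfl) <;> assumption, ⟨p, by simp⟩,
        ncard_le_of_isClique hG (by simp [hpq]), ?_⟩
      rintro v ⟨y, hy, hvy⟩ hP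
      by_contra! hcon
      have hvp := hcon p (by simp)
      have hvq := hcon q (by simp)
      let N := {z | z ∈ A ∧ ¬ G.Adj v z}
      have hDN : G.compIn N p ⊆ N := compIn_subset ⟨hp, hvp⟩
      -- The component of `p` among the nonneighbours of `v` also contains `q`. It is a module: a
      -- vertex `z` outside it that splits it must see `v`, and an edge `cd` inside with only `c`
      -- seen by `z` gives the induced path `v, z, c, d`.
      refine hmod (G.compIn N p) ⟨fun z hz => (hDN hz).1, ?_⟩ ?_ self_mem_compIn
        (mem_compIn_of_adj self_mem_compIn ⟨hp, hvp⟩ ⟨hq, hvq⟩ hpq)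
      · intro z hz hzD a ha b hb hza
        by_contra hzb
        by_cases hvz : G.Adj v z
        · obtain ⟨c, hc, d, hd, -, -, hcd, hzc, hzd⟩ := exists_adj_switch (U := N) (G := G)
            (x := a) (y := b) (fun t => G.Adj z t) hza (by rwa [compIn_eq ha]) hzb
          rw [compIn_eq ha] at hc hd
          exact hzd (hP z hz c (hDN hc).1 d (hDN hd).1 hvz hzc hcd (hDN hc).2 (hDN hd).2)
        · exact hzD (mem_compIn_of_adj ha (hDN ha) ⟨hz, hvz⟩ hza.symm)
      · intro h
        exact (hDN (h ▸ hy)).2 hvy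
    · rw [Set.not_nontrivial_iff] at hnt
      obtain ⟨a, ha⟩ := hne
      refine ⟨{a}, by simpa using ha, ⟨a, rfl⟩, by simpa using hk, ?_⟩
      rintro v ⟨y, hy, hvy⟩ -
      exact ⟨a, rfl, hnt hy ha ▸ hvy⟩
  · push Not at hco
    obtain ⟨x0, hx0, y0, hy0, hxy0⟩ := hco
    obtain ⟨R, hRA, hRc, hRs⟩ := G.exists_clique_transversal A
    obtain ⟨a0, ha0⟩ := hne
    refine ⟨R, hRA, ⟨_, (hRs a0 ha0).choose_spec.1⟩, ncard_le_of_isClique hG hRc, ?_⟩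
    rintro v ⟨y, hy, hvy⟩ hP
    by_contra! hcon
    obtain ⟨r, hr, hyr⟩ := hRs y hy
    obtain ⟨r', hr', hrr'⟩ : ∃ r' ∈ R, r' ∉ Gᶜ.compIn A r := by
      by_contra! hall
      have h : ∀ z ∈ A, z ∈ Gᶜ.compIn A r := by
        intro z hz
        obtain ⟨s, hs, hzs⟩ := hRs z hz
        exact mem_compIn_trans (hall s hs) hzs
      exact hxy0 (mem_compIn_trans (mem_compIn_symm (h x0 hx0)) (h y0 hy0))
    have hfull : ∀ z ∈ A, z ∈ Gᶜ.compIn A r → G.Adj z r' := by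
      intro z hz hzr
      by_contra hzr'
      refine hrr' (mem_compIn_of_adj hzr hz (hRA hr') ((compl_adj _ _ _).2 ⟨?_, hzr'⟩))
      rintro rfl
      exact hrr' hzr
    -- Here `c` and `d` are nonadjacent, `v` sees only `c`, and `r'` sees both but not `v`: the path
    -- `v, c, r', d` is induced.
    obtain ⟨c, hc, d, hd, hcA, hdA, hcd, hvc, hvd⟩ :=
      exists_adj_switch (fun t => G.Adj v t) hvy (mem_compIn_symm hyr) (hcon r hr)
    rw [compIn_eq hyr] at hc hd
    rw [compl_adj] at hcd
    exact hcd.2 (hP c hcA r' (hRA hr') d hdA hvc (hfull c hcA hc) (hfull d hdA hd).symm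
      (hcon r' hr') hvd)

/-! ### Counting minimal separators -/

/-- The vertex sets `X` that separate two components of `G[W] - X`, both of which have all of `X`
in their neighbourhood. -/
def IsMinSepIn (G : SimpleGraph V) (W X : Set V) : Prop :=
  X ⊆ W ∧ ∃ a ∈ W \ X, ∃ b ∈ W \ X, b ∉ G.compIn (W \ X) a ∧
    ∀ x ∈ X, (∃ y ∈ G.compIn (W \ X) a, G.Adj y x) ∧ ∃ y ∈ G.compIn (W \ X) b, G.Adj y x

theorem isIndContained_pathGraph_six {G : SimpleGraph V} {a b c d e f : V}
    (hab : G.Adj a b) (hbc : G.Adj b c) (hcd : G.Adj c d) (hde : G.Adj d e) (hef : G.Adj e f)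
    (hac : ¬ G.Adj a c) (had : ¬ G.Adj a d) (hae : ¬ G.Adj a e) (haf : ¬ G.Adj a f)
    (hbd : ¬ G.Adj b d) (hbe : ¬ G.Adj b e) (hbf : ¬ G.Adj b f)
    (hce : ¬ G.Adj c e) (hcf : ¬ G.Adj c f) (hdf : ¬ G.Adj d f) :
    (pathGraph 6).IsIndContained G := by
  have nac : a ≠ c := by rintro rfl; exact had hcd
  have nad : a ≠ d := by rintro rfl; exact hae hde
  have nae : a ≠ e := by rintro rfl; exact haf hef
  have naf : a ≠ f := by rintro rfl; exact hae hef.symm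
  have nbd : b ≠ d := by rintro rfl; exact hbe hde
  have nbe : b ≠ e := by rintro rfl; exact hbf hef
  have nbf : b ≠ f := by rintro rfl; exact haf hab
  have nce : c ≠ e := by rintro rfl; exact hcf hef
  have ncf : c ≠ f := by rintro rfl; exact hbf hbc
  have ndf : d ≠ f := by rintro rfl; exact hcf hcd
  have key : ∀ i j : Fin 6, i < j → ![a, b, c, d, e, f] i ≠ ![a, b, c, d, e, f] j ∧
      (G.Adj (![a, b, c, d, e, f] i) (![a, b, c, d, e, f] j) ↔ i.val + 1 = j.val) := by
    simp [Fin.forall_fin_succ, *, hab.ne, hbc.ne, hcd.ne, hde.ne, hef.ne]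
  refine ⟨⟨⟨![a, b, c, d, e, f], ?_⟩, ?_⟩⟩
  · intro i j hij
    rcases lt_trichotomy i j with h | h | h
    · exact absurd hij (key i j h).1
    · exact h
    · exact absurd hij.symm (key j i h).1
  · intro i j
    rw [pathGraph_adj]
    rcases lt_trichotomy i j with h | rfl | h
    · refine (key i j h).2.trans ⟨Or.inl, fun h' => h'.resolve_right ?_⟩
      have := Fin.lt_def.1 h
      omega
    · simp
    · refine (G.adj_comm _ _).trans ((key j i h).2.trans ⟨Or.inr, fun h' => h'.resolve_left ?_⟩)
      have := Fin.lt_def.1 h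
      omega

/-- A graph of clique number at most `k` has at most `2 ^ k` sets `T ⊆ Z` complete to `Z \ T`. -/
theorem ncard_complete_splits_le [Finite V] {G : SimpleGraph V} {k : ℕ}
    (hG : G.CliqueFree (k + 1)) (Z : Set V) :
    {T : Set V | T ⊆ Z ∧ ∀ t ∈ T, ∀ z ∈ Z, z ∉ T → G.Adj t z}.ncard ≤ 2 ^ k := by
  obtain ⟨R, -, hRc, hRs⟩ := G.exists_clique_transversal Z
  have hR : (𝒫 R).ncard ≤ 2 ^ k := by
    rw [Set.ncard_powerset R]
    exact Nat.pow_le_pow_right (by norm_num) (ncard_le_of_isClique hG hRc)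
  refine le_trans (Set.ncard_le_ncard_of_injOn (fun T => T ∩ R)
    (fun T _ => Set.inter_subset_right) ?_ (Set.toFinite _)) hR
  -- Such a `T` is a union of components of the complement of `G[Z]`, hence determined by the
  -- representatives it contains.
  have hcl : ∀ T : Set V, (∀ t ∈ T, ∀ z ∈ Z, z ∉ T → G.Adj t z) → ∀ x ∈ T,
      Gᶜ.compIn Z x ⊆ T := by
    intro T hT x hx
    refine compIn_subset_of_closed hx fun y hy _ z hz hyz => ?_
    by_contra hzT
    exact ((compl_adj _ _ _).1 hyz).2 (hT y hy z hz hzT)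
  have hle : ∀ T T' : Set V, T ⊆ Z → (∀ t ∈ T, ∀ z ∈ Z, z ∉ T → G.Adj t z) →
      (∀ t ∈ T', ∀ z ∈ Z, z ∉ T' → G.Adj t z) → T ∩ R = T' ∩ R → T ⊆ T' := by
    intro T T' hTZ hT hT' h x hx
    obtain ⟨r, hr, hxr⟩ := hRs x (hTZ hx)
    have h1 : r ∈ T ∩ R := ⟨hcl T hT x hx (mem_compIn_symm hxr), hr⟩
    rw [h] at h1
    exact hcl T' hT' r h1.1 hxr
  intro T hT T' hT' h
  exact Set.Subset.antisymm (hle T T' hT.1 hT.2 hT'.2 h) (hle T' T hT'.1 hT'.2 hT.2 h.symm)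

/-- The closed neighbours of `b` in `W` that are not adjacent to any of the vertices `p i`. -/
def privateNbhd (G : SimpleGraph V) (W : Set V) {k : ℕ} (p : Fin k → V) (b : V) : Set V :=
  {z | z ∈ W ∧ (z = b ∨ G.Adj b z) ∧ ∀ i, ¬ G.Adj z (p i)}

/-- The component of `b` in `G[W]` after removal of `T` and of the closed neighbourhood of the
vertices `p i`. -/
def remainingComp (G : SimpleGraph V) (W : Set V) {k : ℕ} (p : Fin k → V) (b : V) (T : Set V) :
    Set V :=
  G.compIn (W \ ({y | ∃ i, y = p i ∨ G.Adj y (p i)} ∪ T)) b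

theorem IsMinSepIn.exists_eq_openNbhd [Finite V] {G : SimpleGraph V} {k : ℕ} (hk : 1 ≤ k)
    (hG : G.CliqueFree (k + 1)) (hP6 : ¬ (pathGraph 6).IsIndContained G) {W X : Set V}
    (hX : G.IsMinSepIn W X) :
    ∃ (p : Fin k → V) (b : V), ∃ T ∈ {T : Set V | T ⊆ G.privateNbhd W p b ∧
      ∀ t ∈ T, ∀ z ∈ G.privateNbhd W p b, z ∉ T → G.Adj t z},
      W ∩ G.openNbhd (G.remainingComp W p b T) = X := by
  obtain ⟨hXW, a, ha, b, hb, hab, hfull⟩ := hX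
  set A := G.compIn (W \ X) a
  set B := G.compIn (W \ X) b
  have hAW : A ⊆ W \ X := compIn_subset ha
  have hBW : B ⊆ W \ X := compIn_subset hb
  have hdisj : ∀ x ∈ A, x ∉ B := fun x hxA hxB =>
    hab (mem_compIn_trans hxA (mem_compIn_symm hxB))
  have hanti : ∀ x ∈ A, ∀ y ∈ B, ¬ G.Adj x y := fun x hxA y hyB h =>
    hdisj y (mem_compIn_of_adj hxA (hAW hxA) (hBW hyB) h) hyB
  obtain ⟨p, hpA, hp⟩ := exists_dominating hk hG (A := A) ⟨a, self_mem_compIn⟩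
    fun x hx y hy => compIn_connected hx hy
  have hdom : ∀ v ∈ X, (∀ i, ¬ G.Adj v (p i)) → ∀ y ∈ B, G.Adj v y := by
    intro v hv hvp y hy
    by_contra hvy
    obtain ⟨y0, hy0, hy0v⟩ := (hfull v hv).1
    obtain ⟨y1, hy1, hy1v⟩ := (hfull v hv).2
    obtain ⟨e, he, f, hf, -, -, hef, hve, hvf⟩ := exists_adj_switch (G := G) (U := W \ X)
      (x := y1) (y := y) (fun t => G.Adj v t) hy1v.symm (by rwa [compIn_eq hy1]) hvy
    rw [compIn_eq hy1] at he hf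
    obtain ⟨i, hi⟩ := hp v ⟨y0, hy0, hy0v.symm⟩ (by
      intro x hx y hy z hz hvx hxy hyz hvy hvz
      by_contra hxz
      -- The induced path is `z, y, x, v, e, f`: three vertices in `A`, then `v ∈ X`, then two in
      -- `B`.
      exact hP6 (isIndContained_pathGraph_six hyz.symm hxy.symm hvx.symm hve hef
        (fun h => hxz h.symm) (fun h => hvz h.symm) (hanti z hz e he) (hanti z hz f hf)
        (fun h => hvy h.symm) (hanti y hy e he) (hanti y hy f hf)
        (hanti x hx e he) (hanti x hx f hf) hvf))
    exact hvp i hi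
  have hZ : ∀ z ∈ G.privateNbhd W p b, z ∉ X → z ∈ B := by
    rintro z ⟨hzW, rfl | hbz, -⟩ hzX
    · exact self_mem_compIn
    · exact mem_compIn_of_adj self_mem_compIn hb ⟨hzW, hzX⟩ hbz
  refine ⟨p, b, G.privateNbhd W p b ∩ X, ⟨Set.inter_subset_left, ?_⟩, ?_⟩
  · rintro t ⟨htZ, htX⟩ z hz hzT
    exact hdom t htX htZ.2.2 z (hZ z hz fun h => hzT ⟨hz, h⟩)
  · have hcomp : G.remainingComp W p b (G.privateNbhd W p b ∩ X) = B := by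
      refine Set.Subset.antisymm ?_ (compIn_subset_compIn ?_)
      · refine compIn_subset_of_closed self_mem_compIn fun y hy _ z hz hyz => ?_
        by_cases hzX : z ∈ X
        · exfalso
          have hzp : ∀ i, ¬ G.Adj z (p i) := fun i h => hz.2 (Or.inl ⟨i, Or.inr h⟩)
          exact hz.2 (Or.inr ⟨⟨hz.1, Or.inr (hdom z hzX hzp b self_mem_compIn).symm, hzp⟩, hzX⟩)
        · exact mem_compIn_of_adj hy (hBW hy) ⟨hz.1, hzX⟩ hyz
      · intro y hy
        refine ⟨(hBW hy).1, ?_⟩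
        rintro (⟨i, rfl | h⟩ | h)
        · exact hdisj _ (hpA i) hy
        · exact hanti _ (hpA i) y hy h.symm
        · exact (hBW hy).2 h.2
    rw [hcomp]
    ext x
    constructor
    · rintro ⟨hxW, hxB, y, hy, hyx⟩
      by_contra hxX
      exact hxB (mem_compIn_of_adj hy (hBW hy) ⟨hxW, hxX⟩ hyx)
    · intro hx
      obtain ⟨y, hy, hyx⟩ := (hfull x hx).2
      exact ⟨hXW hx, fun h => (hBW h).2 hx, y, hy, hyx⟩

/-- A `P₆`-free graph on `n` vertices without clique on `k + 1` vertices has at most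
`2 ^ k * n ^ (k + 1)` minimal separators. -/
theorem ncard_isMinSepIn_le [Fintype V] {G : SimpleGraph V} {k : ℕ} (hk : 1 ≤ k)
    (hG : G.CliqueFree (k + 1)) (hP6 : ¬ (pathGraph 6).IsIndContained G) (W : Set V) :
    {X | G.IsMinSepIn W X}.ncard ≤ 2 ^ k * Fintype.card V ^ (k + 1) := by
  classical
  let F : (Fin k → V) × V → Set (Set V) := fun q =>
    (fun T => W ∩ G.openNbhd (G.remainingComp W q.1 q.2 T)) ''
      {T : Set V | T ⊆ G.privateNbhd W q.1 q.2 ∧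
        ∀ t ∈ T, ∀ z ∈ G.privateNbhd W q.1 q.2, z ∉ T → G.Adj t z}
  have hsub : {X | G.IsMinSepIn W X} ⊆ ⋃ q ∈ Finset.univ, F q := by
    intro X hX
    obtain ⟨p, b, T, hT, h⟩ := IsMinSepIn.exists_eq_openNbhd hk hG hP6 hX
    simp only [Finset.mem_univ, Set.iUnion_true, Set.mem_iUnion]
    exact ⟨(p, b), T, hT, h⟩
  have hF : ∀ q, (F q).ncard ≤ 2 ^ k := fun q =>
    (Set.ncard_image_le (Set.toFinite _)).trans (ncard_complete_splits_le hG _)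
  calc _ ≤ (⋃ q ∈ Finset.univ, F q).ncard := Set.ncard_le_ncard hsub (Set.toFinite _)
    _ ≤ ∑ q, (F q).ncard := Finset.set_ncard_biUnion_le _ _
    _ ≤ ∑ _q : (Fin k → V) × V, 2 ^ k := Finset.sum_le_sum fun q _ => hF q
    _ = 2 ^ k * Fintype.card V ^ (k + 1) := by
      simp [Fintype.card_prod, pow_succ, mul_comm]

/-- Minimal separators in terms of `compIn`. -/
theorem IsMinimalSeparator.isMinSepIn {G : SimpleGraph V} {X : Set V}
    (h : G.IsMinimalSeparator X) : G.IsMinSepIn Set.univ X := by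
  obtain ⟨A, B, hAB, hA, hB⟩ := h
  obtain ⟨a, rfl⟩ := A.exists_rep
  obtain ⟨b, rfl⟩ := B.exists_rep
  have hfull : ∀ c : (Xᶜ : Set V), G.IsFullComponent X (Quot.mk _ c) → ∀ x ∈ X,
      ∃ y ∈ G.compIn Xᶜ c, G.Adj y x := by
    intro c hc x hx
    obtain ⟨-, _, ⟨y, hy, rfl⟩, hyx⟩ := (Set.ext_iff.1 hc x).2 hx
    refine ⟨y, (mem_compIn_iff_reachable c.2).2 ⟨y.2, ?_⟩, hyx⟩
    exact (ConnectedComponent.exact hy).symm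
  refine ⟨Set.subset_univ _, a, ⟨trivial, a.2⟩, b, ⟨trivial, b.2⟩, ?_⟩
  rw [← Set.compl_eq_univ_sdiff]
  refine ⟨fun hab => ?_, fun x hx => ⟨hfull a hA x hx, hfull b hB x hx⟩⟩
  obtain ⟨_, hr⟩ := (mem_compIn_iff_reachable a.2).1 hab
  exact hAB (ConnectedComponent.sound hr)

/-! ### Counting potential maximal cliques by vertex deletion -/

/-- The combinatorial properties of the potential maximal cliques `Ω` of `G[W]`: no component of
`G[W] - Ω` has all of `Ω` in its neighbourhood, and every two nonadjacent vertices of `Ω` lie in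
the neighbourhood of a common component. -/
structure IsCliquishIn (G : SimpleGraph V) (W Ω : Set V) : Prop where
  subset : Ω ⊆ W
  not_full : ∀ x ∈ W \ Ω, ∃ w ∈ Ω, ∀ y ∈ G.compIn (W \ Ω) x, ¬ G.Adj y w
  cover : ∀ u ∈ Ω, ∀ v ∈ Ω, u ≠ v → ¬ G.Adj u v → ∃ x ∈ W \ Ω,
    (∃ y ∈ G.compIn (W \ Ω) x, G.Adj y u) ∧ ∃ y ∈ G.compIn (W \ Ω) x, G.Adj y v

section

variable {G : SimpleGraph V} {W Ω : Set V}

/-- The neighbourhood of a component of `G[W] - Ω` is a minimal separator. -/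
theorem IsCliquishIn.isMinSepIn (h : G.IsCliquishIn W Ω) {x : V} (hx : x ∈ W \ Ω) :
    G.IsMinSepIn W {s | s ∈ Ω ∧ ∃ y ∈ G.compIn (W \ Ω) x, G.Adj y s} := by
  set S := {s | s ∈ Ω ∧ ∃ y ∈ G.compIn (W \ Ω) x, G.Adj y s}
  have hSΩ : S ⊆ Ω := fun s hs => hs.1
  have hsub : W \ Ω ⊆ W \ S := Set.sdiff_subset_sdiff_right hSΩ
  -- The second full component is the one of `w`: it reaches each `s ∈ S` by an edge or through a
  -- component that `cover` provides for `w` and `s`.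
  obtain ⟨w, hw, hwx⟩ := h.not_full x hx
  have hwS : w ∈ W \ S := ⟨h.subset hw, fun ⟨_, y, hy, hyw⟩ => hwx y hy hyw⟩
  refine ⟨hSΩ.trans h.subset, x, hsub hx, w, hwS, ?_, fun s hs => ⟨?_, ?_⟩⟩
  · have : G.compIn (W \ S) x ⊆ G.compIn (W \ Ω) x := by
      refine compIn_subset_of_closed self_mem_compIn fun y hy _ z hz hyz => ?_
      by_cases hzΩ : z ∈ Ω
      · exact absurd ⟨hzΩ, y, hy, hyz⟩ hz.2
      · exact mem_compIn_of_adj hy (compIn_subset hx hy) ⟨hz.1, hzΩ⟩ hyz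
    exact fun hwc => (compIn_subset hx (this hwc)).2 hw
  · obtain ⟨-, y, hy, hys⟩ := hs
    exact ⟨y, compIn_mono hsub hy, hys⟩
  · by_cases hws : G.Adj w s
    · exact ⟨w, self_mem_compIn, hws⟩
    · have hne : w ≠ s := fun e => hwS.2 (e ▸ hs)
      obtain ⟨x', hx', ⟨y, hy, hyw⟩, z, hz, hzs⟩ := h.cover w hw s hs.1 hne hws
      refine ⟨z, ?_, hzs⟩
      have hyz : z ∈ G.compIn (W \ Ω) y := by rwa [compIn_eq hy]
      exact mem_compIn_trans (mem_compIn_of_adj self_mem_compIn hwS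
        (hsub (compIn_subset hx' hy)) hyw.symm) (compIn_mono hsub hyz)

/-- Every set that separates `u` from `v` contains a minimal separator with this property. -/
theorem exists_isMinSepIn_subset {T : Set V} {u v : V} (hTW : T ⊆ W) (hu : u ∈ W \ T)
    (hv : v ∈ W \ T) (huv : v ∉ G.compIn (W \ T) u) :
    ∃ S ⊆ T, G.IsMinSepIn W S ∧ v ∉ G.compIn (W \ S) u := by
  set C := G.compIn (W \ T) u
  -- Shrinking twice makes both sides full: first to what the component of `u` sees, then to what
  -- the component of `v` sees.
  set T₁ := {t | t ∈ T ∧ ∃ y ∈ C, G.Adj y t}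
  have hT₁T : T₁ ⊆ T := fun t ht => ht.1
  have hsub₁ : W \ T ⊆ W \ T₁ := Set.sdiff_subset_sdiff_right hT₁T
  have hC₁ : G.compIn (W \ T₁) u ⊆ C := by
    refine compIn_subset_of_closed self_mem_compIn fun y hy _ z hz hyz => ?_
    by_cases hzT : z ∈ T
    · exact absurd ⟨hzT, y, hy, hyz⟩ hz.2
    · exact mem_compIn_of_adj hy (compIn_subset hu hy) ⟨hz.1, hzT⟩ hyz
  set D := G.compIn (W \ T₁) v
  have huD : u ∉ D := fun h => huv (hC₁ (mem_compIn_symm h))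
  set S := {t | t ∈ T₁ ∧ ∃ y ∈ D, G.Adj y t}
  have hST₁ : S ⊆ T₁ := fun t ht => ht.1
  have hsub : W \ T₁ ⊆ W \ S := Set.sdiff_subset_sdiff_right hST₁
  have hD₁ : G.compIn (W \ S) v ⊆ D := by
    refine compIn_subset_of_closed self_mem_compIn fun y hy _ z hz hyz => ?_
    by_cases hzT : z ∈ T₁
    · exact absurd ⟨hzT, y, hy, hyz⟩ hz.2
    · exact mem_compIn_of_adj hy (compIn_subset (hsub₁ hv) hy) ⟨hz.1, hzT⟩ hyz
  have hsep : v ∉ G.compIn (W \ S) u := fun h => huD (hD₁ (mem_compIn_symm h))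
  refine ⟨S, hST₁.trans hT₁T, ⟨(hST₁.trans hT₁T).trans hTW, u, hsub (hsub₁ hu), v,
    hsub (hsub₁ hv), hsep, fun s hs => ⟨?_, ?_⟩⟩, hsep⟩
  · obtain ⟨y, hy, hys⟩ := (hST₁ hs).2
    exact ⟨y, compIn_mono (hsub₁.trans hsub) hy, hys⟩
  · obtain ⟨y, hy, hys⟩ := hs.2
    exact ⟨y, compIn_mono hsub hy, hys⟩

/-- Deleting `a ∈ Ω` leaves the components outside `Ω` unchanged, so only `not_full` can fail. Then
some component sees all of `Ω \ {a}`, and its neighbourhood in `Ω` is the separator `S`. -/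
theorem IsCliquishIn.sdiff_singleton_of_mem {a : V} (h : G.IsCliquishIn W Ω) (ha : a ∈ Ω) :
    G.IsCliquishIn (W \ {a}) (Ω \ {a}) ∨ ∃ S, G.IsMinSepIn W S ∧ Ω = S ∪ {a} := by
  have hU : (W \ {a}) \ (Ω \ {a}) = W \ Ω := by
    ext x
    by_cases hx : x = a
    · subst hx
      simp [ha]
    · simp [hx]
  by_cases hnf : ∀ x ∈ W \ Ω, ∃ w ∈ Ω \ {a}, ∀ y ∈ G.compIn (W \ Ω) x, ¬ G.Adj y w
  · refine Or.inl ⟨Set.sdiff_subset_sdiff_left h.subset, by rwa [hU], ?_⟩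
    rw [hU]
    exact fun u hu v hv => h.cover u hu.1 v hv.1
  · push Not at hnf
    obtain ⟨x, hx, hfull⟩ := hnf
    refine Or.inr ⟨_, h.isMinSepIn hx, ?_⟩
    ext w
    constructor
    · intro hw
      by_cases hwa : w = a
      · exact Or.inr hwa
      · exact Or.inl ⟨hw, hfull w ⟨hw, hwa⟩⟩
    · rintro (hw | rfl)
      · exact hw.1
      · exact ha

/-- Only `cover` can fail, for some pair `u`, `v` covered solely through the component of `a`. Take
`S` to be the neighbourhood in `Ω` of that component, and `T` a minimal separator of `u` and `v`
inside `T₀`. -/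
theorem IsCliquishIn.sdiff_singleton_of_notMem {a : V} (h : G.IsCliquishIn W Ω) (haW : a ∈ W)
    (ha : a ∉ Ω) : G.IsCliquishIn (W \ {a}) Ω ∨
      ∃ S T, G.IsMinSepIn W S ∧ G.IsMinSepIn W T ∧ Ω = S ∪ T \ {a} := by
  have hU : (W \ {a}) \ Ω = (W \ Ω) \ {a} := Set.sdiff_sdiff_comm
  by_cases hcov : ∀ u ∈ Ω, ∀ v ∈ Ω, u ≠ v → ¬ G.Adj u v → ∃ x ∈ (W \ Ω) \ {a},
    (∃ y ∈ G.compIn ((W \ Ω) \ {a}) x, G.Adj y u) ∧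
      ∃ y ∈ G.compIn ((W \ Ω) \ {a}) x, G.Adj y v
  · refine Or.inl ⟨fun x hx => ⟨h.subset hx, fun e => ha (e ▸ hx)⟩, ?_, by rwa [hU]⟩
    rw [hU]
    intro x hx
    obtain ⟨w, hw, hwx⟩ := h.not_full x hx.1
    exact ⟨w, hw, fun y hy => hwx y (compIn_mono Set.sdiff_subset hy)⟩
  right
  push Not at hcov
  obtain ⟨u, hu, v, hv, hne, huv, hno⟩ := hcov
  have haU : a ∈ W \ Ω := ⟨haW, ha⟩
  set U := W \ Ω
  have huvS : (∃ y ∈ G.compIn U a, G.Adj y u) ∧ ∃ y ∈ G.compIn U a, G.Adj y v := by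
    obtain ⟨x, hx, ⟨y, hy, hyu⟩, z, hz, hzv⟩ := h.cover u hu v hv hne huv
    have hax : a ∈ G.compIn U x := by
      by_contra hax
      have hs := compIn_subset_sdiff_singleton hx hax
      exact hno x ⟨hx, fun e => hax (e ▸ self_mem_compIn)⟩ ⟨y, hs hy, hyu⟩ z (hs hz) hzv
    rw [compIn_eq hax]
    exact ⟨⟨y, hy, hyu⟩, z, hz, hzv⟩
  have hS := h.isMinSepIn haU
  set S := {s | s ∈ Ω ∧ ∃ y ∈ G.compIn U a, G.Adj y s}
  let T₀ : Set V := Ω \ {u, v} ∪ {a}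
  have hWT : ∀ z ∈ W \ T₀, z = u ∨ z = v ∨ z ∈ U \ {a} := by
    intro z hz
    by_cases hzu : z = u
    · exact Or.inl hzu
    by_cases hzv : z = v
    · exact Or.inr (Or.inl hzv)
    · refine Or.inr (Or.inr ⟨⟨hz.1, fun hzΩ => hz.2 (Or.inl ⟨hzΩ, ?_⟩)⟩, fun e => hz.2 (Or.inr e)⟩)
      simp [hzu, hzv]
  have hT₀W : T₀ ⊆ W := by
    rintro z (hz | rfl)
    · exact h.subset hz.1
    · exact haW
  have hua : u ≠ a := fun e => ha (e ▸ hu)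
  have hva : v ≠ a := fun e => ha (e ▸ hv)
  have huT : u ∈ W \ T₀ := ⟨h.subset hu, by simp [T₀, hua]⟩
  have hvT : v ∈ W \ T₀ := ⟨h.subset hv, by simp [T₀, hva]⟩
  have hsep : v ∉ G.compIn (W \ T₀) u := by
    have hsub : G.compIn (W \ T₀) u ⊆
        {u} ∪ {z | z ∈ U \ {a} ∧ ∃ y ∈ G.compIn (U \ {a}) z, G.Adj y u} := by
      refine compIn_subset_of_closed (Or.inl rfl) fun y hy _ z hz hyz => ?_
      rcases hWT z hz with rfl | rfl | hzU
      · exact Or.inl rfl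
      · rcases hy with rfl | ⟨hyU, hyu⟩
        · exact absurd hyz huv
        · exact absurd hyz (hno y hyU hyu y self_mem_compIn)
      · refine Or.inr ⟨hzU, ?_⟩
        rcases hy with rfl | ⟨hyU, t, ht, htu⟩
        · exact ⟨z, self_mem_compIn, hyz.symm⟩
        · refine ⟨t, ?_, htu⟩
          rwa [compIn_eq (mem_compIn_of_adj self_mem_compIn hyU hzU hyz)]
    intro hvc
    rcases hsub hvc with e | hvU
    · exact hne e.symm
    · exact hvU.1.1.2 hv
  obtain ⟨T, hTT₀, hT, hTsep⟩ := exists_isMinSepIn_subset hT₀W huT hvT hsep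
  refine ⟨S, T, hS, hT, Set.Subset.antisymm ?_ ?_⟩
  · intro x hx
    by_contra hcon
    have hxS : x ∉ S := fun e => hcon (Or.inl e)
    have hxa : x ≠ a := fun e => ha (e ▸ hx)
    have hxT : x ∉ T := fun e => hcon (Or.inr ⟨e, hxa⟩)
    -- A component covering `w` and `x ∉ S` is not that of `a`, so it avoids `T ⊆ Ω ∪ {a}`. Thus `x`
    -- would be joined to both `u` and `v` outside `T`.
    have hconn : ∀ w ∈ Ω, w ∈ S → w ∈ W \ T → x ∈ G.compIn (W \ T) w := by
      intro w hw hwS hwT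
      by_cases hwx : G.Adj w x
      · exact mem_compIn_of_adj self_mem_compIn hwT ⟨h.subset hx, hxT⟩ hwx
      obtain ⟨t, ht, ⟨y, hy, hyw⟩, z, hz, hzx⟩ :=
        h.cover w hw x hx (fun e => hxS (e ▸ hwS)) hwx
      have hat : a ∉ G.compIn U t := by
        intro hat
        exact hxS ⟨hx, z, by rwa [compIn_eq hat], hzx⟩
      have hin : G.compIn U t ⊆ W \ T := by
        intro s hs
        have hsU := compIn_subset ht hs
        refine ⟨hsU.1, fun hsT => ?_⟩
        rcases hTT₀ hsT with hs' | rfl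
        · exact hsU.2 hs'.1
        · exact hat hs
      have hyz : z ∈ G.compIn (W \ T) y :=
        mem_compIn_trans (mem_compIn_symm (compIn_subset_compIn hin hy))
          (compIn_subset_compIn hin hz)
      exact mem_compIn_of_adj (mem_compIn_trans
        (mem_compIn_of_adj self_mem_compIn hwT (hin hy) hyw.symm) hyz) (hin hz)
          ⟨h.subset hx, hxT⟩ hzx
    have h1 := hconn u hu ⟨hu, huvS.1⟩ ⟨huT.1, fun e => huT.2 (hTT₀ e)⟩
    have h2 := hconn v hv ⟨hv, huvS.2⟩ ⟨hvT.1, fun e => hvT.2 (hTT₀ e)⟩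
    exact hTsep (mem_compIn_trans h1 (mem_compIn_symm h2))
  · rintro x (hx | ⟨hx, hxa⟩)
    · exact hx.1
    · rcases hTT₀ hx with hx' | hx'
      · exact hx'.1
      · exact absurd hx' hxa

/-- This makes `Ω ↦ Ω \ {a}` injective on the surviving sets. The component of `a` outside `Ω`
misses some `w ∈ Ω`, but a component covering `a` and `w` would be part of it. -/
theorem IsCliquishIn.not_insert {a : V} (h : G.IsCliquishIn W Ω) (ha : a ∉ Ω) :
    ¬ G.IsCliquishIn W (insert a Ω) := by
  intro h'
  have haU : a ∈ W \ Ω := ⟨h'.subset (Set.mem_insert _ _), ha⟩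
  obtain ⟨w, hw, hwa⟩ := h.not_full a haU
  have hsub : W \ insert a Ω ⊆ W \ Ω := Set.sdiff_subset_sdiff_right (Set.subset_insert _ _)
  obtain ⟨x, hx, ⟨y, hy, hya⟩, z, hz, hzw⟩ := h'.cover a (Set.mem_insert _ _) w
    (Set.mem_insert_of_mem _ hw) (fun e => ha (e ▸ hw)) (hwa a self_mem_compIn)
  have hyz : z ∈ G.compIn (W \ Ω) y := compIn_mono hsub (by rwa [compIn_eq hy])
  exact hwa z (mem_compIn_trans (mem_compIn_of_adj self_mem_compIn haU
    (hsub (compIn_subset hx hy)) hya.symm) hyz) hzw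

theorem ncard_isCliquishIn_le_add [Finite V] {a : V} (ha : a ∈ W) {s : ℕ}
    (hs : {X | G.IsMinSepIn W X}.ncard ≤ s) :
    {Ω | G.IsCliquishIn W Ω}.ncard ≤ {Ω | G.IsCliquishIn (W \ {a}) Ω}.ncard + (s + s * s) := by
  set M := {X | G.IsMinSepIn W X}
  let P : Set (Set V) := {Ω | G.IsCliquishIn W Ω ∧ G.IsCliquishIn (W \ {a}) (Ω \ {a})}
  let Q : Set (Set V) := (fun S => S ∪ {a}) '' M
  let R : Set (Set V) := (fun q : Set V × Set V => q.1 ∪ q.2 \ {a}) '' (M ×ˢ M)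
  have hsub : {Ω | G.IsCliquishIn W Ω} ⊆ P ∪ (Q ∪ R) := by
    intro Ω hΩ
    by_cases haΩ : a ∈ Ω
    · rcases IsCliquishIn.sdiff_singleton_of_mem hΩ haΩ with h | ⟨S, hS, rfl⟩
      · exact Or.inl ⟨hΩ, h⟩
      · exact Or.inr (Or.inl ⟨S, hS, rfl⟩)
    · rcases IsCliquishIn.sdiff_singleton_of_notMem hΩ ha haΩ with h | ⟨S, T, hS, hT, rfl⟩
      · exact Or.inl ⟨hΩ, by rwa [Set.sdiff_singleton_eq_self haΩ]⟩
      · exact Or.inr (Or.inr ⟨(S, T), ⟨hS, hT⟩, rfl⟩)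
  have hP : P.ncard ≤ {Ω | G.IsCliquishIn (W \ {a}) Ω}.ncard := by
    refine Set.ncard_le_ncard_of_injOn (fun Ω => Ω \ {a}) (fun Ω hΩ => hΩ.2) ?_ (Set.toFinite _)
    rintro Ω hΩ Ω' hΩ' (h : Ω \ {a} = Ω' \ {a})
    by_cases h1 : a ∈ Ω <;> by_cases h2 : a ∈ Ω'
    · rw [← Set.insert_sdiff_self_of_mem h1, h, Set.insert_sdiff_self_of_mem h2]
    · rw [Set.sdiff_singleton_eq_self h2] at h
      exact absurd (by rw [← h, Set.insert_sdiff_self_of_mem h1]; exact hΩ.1)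
        (hΩ'.1.not_insert h2)
    · rw [Set.sdiff_singleton_eq_self h1] at h
      exact absurd (by rw [h, Set.insert_sdiff_self_of_mem h2]; exact hΩ'.1)
        (hΩ.1.not_insert h1)
    · rwa [Set.sdiff_singleton_eq_self h1, Set.sdiff_singleton_eq_self h2] at h
  have hQ : Q.ncard ≤ s := (Set.ncard_image_le (Set.toFinite _)).trans hs
  have hR : R.ncard ≤ s * s := by
    refine (Set.ncard_image_le (Set.toFinite _)).trans ?_
    rw [Set.ncard_prod]
    exact Nat.mul_le_mul hs hs
  calc _ ≤ (P ∪ (Q ∪ R)).ncard := Set.ncard_le_ncard hsub (Set.toFinite _)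
    _ ≤ P.ncard + (Q ∪ R).ncard := Set.ncard_union_le _ _
    _ ≤ P.ncard + (Q.ncard + R.ncard) := Nat.add_le_add_left (Set.ncard_union_le _ _) _
    _ ≤ _ := by omega

/-- The separator bound is needed for all `W`, since the induction runs through induced subgraphs
down to the empty one, where only `∅` remains. -/
theorem ncard_isCliquishIn_le [Finite V] {s : ℕ}
    (hs : ∀ W : Set V, {X | G.IsMinSepIn W X}.ncard ≤ s) (W : Set V) :
    {Ω | G.IsCliquishIn W Ω}.ncard ≤ 1 + W.ncard * (s + s * s) := by
  induction W, W.toFinite using Set.Finite.induction_on with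
  | empty =>
    have : {Ω | G.IsCliquishIn ∅ Ω} ⊆ {∅} := fun Ω hΩ => Set.subset_empty_iff.1 hΩ.subset
    simpa using Set.ncard_le_ncard this
  | @insert a W ha _ ih =>
    have h := ncard_isCliquishIn_le_add (Set.mem_insert a W) (hs (insert a W))
    rw [Set.insert_sdiff_self_of_notMem ha] at h
    rw [Set.ncard_insert_of_notMem ha]
    linarith

end

/-! ### Chordal graphs and minimal triangulations -/

/-- The vertices `g 0, …, g (m - 1)` form an induced cycle of `H` in this cyclic order. -/
def IsInducedCycle (H : SimpleGraph V) (m : ℕ) (g : ℕ → V) : Prop :=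
  ∀ i j, i < j → j < m → g i ≠ g j ∧ (H.Adj (g i) (g j) ↔ j = i + 1 ∨ (i = 0 ∧ j + 1 = m))

theorem cycleGraph_adj_of_lt {m : ℕ} {i j : Fin m} (h : i < j) :
    (cycleGraph m).Adj i j ↔ j.val = i.val + 1 ∨ (i.val = 0 ∧ j.val + 1 = m) := by
  have h1 := Fin.sub_val_of_le h.le
  have h2 := Fin.coe_sub_iff_lt.2 h
  have h3 := j.2
  have h4 := Fin.lt_def.1 h
  rw [cycleGraph_adj', h1, h2]
  omega

theorem IsChordal.not_isInducedCycle {H : SimpleGraph V} (hH : H.IsChordal) {m : ℕ} (hm : 4 ≤ m)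
    {g : ℕ → V} : ¬ H.IsInducedCycle m g := by
  intro hg
  refine hH m hm ⟨⟨⟨fun i => g i, ?_⟩, ?_⟩⟩
  · intro i j hij
    rcases lt_trichotomy i j with h | h | h
    · exact absurd hij (hg i j h j.2).1
    · exact h
    · exact absurd hij.symm (hg j i h i.2).1
  · intro i j
    rcases lt_trichotomy i j with h | rfl | h
    · exact (hg i j h j.2).2.trans (cycleGraph_adj_of_lt h).symm
    · simp
    · rw [adj_comm, adj_comm (cycleGraph m)]
      exact (hg j i h i.2).2.trans (cycleGraph_adj_of_lt h).symm

/-- An induced cycle can be traversed starting at any of its vertices. -/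
theorem exists_isInducedCycle {H : SimpleGraph V} {m : ℕ} (hm : 4 ≤ m) (f : cycleGraph m ↪g H)
    (i₀ : Fin m) : ∃ g : ℕ → V, H.IsInducedCycle m g ∧ g 0 = f i₀ ∧ ∀ i, ∃ j < m, g j = f i := by
  obtain ⟨n, rfl⟩ : ∃ n, m = n + 4 := ⟨m - 4, by omega⟩
  refine ⟨fun j => f (i₀ + Fin.ofNat (n + 4) j), ?_, by simp, ?_⟩
  · intro i j hij hj
    have hlt : (Fin.ofNat (n + 4) i) < Fin.ofNat (n + 4) j := by
      rw [Fin.lt_def, Fin.val_ofNat, Fin.val_ofNat, Nat.mod_eq_of_lt hj,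
        Nat.mod_eq_of_lt (hij.trans hj)]
      exact hij
    have hadj : (cycleGraph (n + 4)).Adj (i₀ + Fin.ofNat (n + 4) i) (i₀ + Fin.ofNat (n + 4) j) ↔
        (cycleGraph (n + 4)).Adj (Fin.ofNat (n + 4) i) (Fin.ofNat (n + 4) j) := by
      rw [cycleGraph_adj', cycleGraph_adj', add_sub_add_left_eq_sub, add_sub_add_left_eq_sub]
    constructor
    · intro h
      exact hlt.ne (add_left_cancel (f.injective h))
    · rw [f.map_adj_iff, hadj, cycleGraph_adj_of_lt hlt, Fin.val_ofNat, Fin.val_ofNat,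
        Nat.mod_eq_of_lt hj, Nat.mod_eq_of_lt (hij.trans hj)]
  · intro i
    refine ⟨(i - i₀).val, (i - i₀).2, ?_⟩
    simp

/-- If the neighbourhood of `D` is a clique of a minimal triangulation, then the triangulation
has no edge from `D` to a vertex outside `D` and its neighbourhood. -/
theorem IsMinimalTriangulation.mem_openNbhd {G H : SimpleGraph V}
    (hH : G.IsMinimalTriangulation H) {D : Set V} (hN : H.IsClique (G.openNbhd D)) {x u : V}
    (hx : x ∈ D) (hu : u ∉ D) (hxu : H.Adj x u) : u ∈ G.openNbhd D := by
  set N := G.openNbhd D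
  have hND : ∀ y ∈ N, y ∉ D := fun y hy => hy.1
  by_contra huN
  -- Dropping all edges from `D` to the outside of `D ∪ N` keeps the graph chordal, which
  -- contradicts minimality.
  let H' : SimpleGraph V :=
    { Adj := fun a b => H.Adj a b ∧ ¬ (a ∈ D ∧ b ∉ D ∧ b ∉ N) ∧ ¬ (b ∈ D ∧ a ∉ D ∧ a ∉ N)
      symm := ⟨fun a b h => ⟨h.1.symm, h.2.2, h.2.1⟩⟩
      loopless := ⟨fun a h => H.loopless.irrefl a h.1⟩ }
  have hGH' : G ≤ H' := by
    intro a b hab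
    refine ⟨hH.prop.1 hab, fun h => h.2.2 ⟨h.2.1, a, h.1, hab⟩,
      fun h => h.2.2 ⟨h.2.1, b, h.1, hab.symm⟩⟩
  have hH'H : H' ≤ H := fun a b h => h.1
  have hchord : H'.IsChordal := by
    rintro m hm ⟨f⟩
    have hemb : (∀ i j, H.Adj (f i) (f j) → H'.Adj (f i) (f j)) → False := fun h =>
      hH.prop.2 m hm ⟨⟨f.toEmbedding, fun {i j} =>
        ⟨fun h' => f.map_adj_iff.1 (h i j h'), fun h' => hH'H (f.map_adj_iff.2 h')⟩⟩⟩
    obtain ⟨i₀, hi₀⟩ : ∃ i, f i ∈ D := by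
      by_contra! hcon
      exact hemb fun i j h => ⟨h, fun h => hcon i h.1, fun h => hcon j h.1⟩
    obtain ⟨j₀, hj₀D, hj₀N⟩ : ∃ j, f j ∉ D ∧ f j ∉ N := by
      by_contra! hcon
      exact hemb fun i j h => ⟨h, fun h => h.2.2 (hcon j h.2.1), fun h => h.2.2 (hcon i h.2.1)⟩
    obtain ⟨g, hg, hg0, hgf⟩ := exists_isInducedCycle hm f i₀
    obtain ⟨j, hjm, hj⟩ := hgf j₀
    rw [← hg0] at hi₀
    rw [← hj] at hj₀D hj₀N
    have hj0 : j ≠ 0 := by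
      rintro rfl
      exact hj₀D hi₀
    have hstep : ∀ i, i + 1 < m → H'.Adj (g i) (g (i + 1)) := fun i hi =>
      (hg i (i + 1) (by omega) hi).2.2 (Or.inl rfl)
    -- An induced cycle of `H'` that is not one of `H` meets both `D` and the outside of `D ∪ N`.
    -- Both its arcs between them pass through the clique `N`, which gives a chord.
    obtain ⟨k₁, hk₁, hk₁N⟩ : ∃ k ≤ j, g k ∈ N := by
      by_contra! hcon
      have : ∀ i, i ≤ j → g i ∈ D := by
        intro i
        induction i with
        | zero => exact fun _ => hi₀
        | succ i ih =>
          intro hi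
          by_contra hD
          exact (hstep i (by omega)).2.1 ⟨ih (by omega), hD, hcon _ hi⟩
      exact hj₀D (this j le_rfl)
    obtain ⟨k₂, hjk₂, hk₂m, hk₂N⟩ : ∃ k, j ≤ k ∧ k < m ∧ g k ∈ N := by
      by_contra! hcon
      have hout : ∀ i, j ≤ i → i < m → g i ∉ D := by
        intro i hji
        induction i, hji using Nat.le_induction with
        | base => exact fun _ => hj₀D
        | succ i hi ih =>
          intro him hD
          exact (hstep i him).2.2 ⟨hD, ih (by omega), hcon i hi (by omega)⟩
      have hadj := (hg 0 (m - 1) (by omega) (by omega)).2.2 (Or.inr ⟨rfl, by omega⟩)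
      exact hadj.2.1 ⟨hi₀, hout (m - 1) (by omega) (by omega), hcon _ (by omega) (by omega)⟩
    have hk₁0 : k₁ ≠ 0 := by
      rintro rfl
      exact hND _ hk₁N hi₀
    have hk₁j : k₁ ≠ j := by
      rintro rfl
      exact hj₀N hk₁N
    have hk₂j : k₂ ≠ j := by
      rintro rfl
      exact hj₀N hk₂N
    have hc := hg k₁ k₂ (by omega) hk₂m
    have hadj : H'.Adj (g k₁) (g k₂) :=
      ⟨hN hk₁N hk₂N hc.1, fun h => hND _ hk₁N h.1, fun h => hND _ hk₂N h.1⟩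
    have := hc.2.1 hadj
    omega
  exact (hH.le_of_le ⟨hGH', hchord⟩ hH'H hxu).2.1 ⟨hx, hu, huN⟩

/-- The ends of a fill edge of a minimal triangulation have two nonadjacent common neighbours. -/
theorem IsMinimalTriangulation.exists_common_nbrs {G H : SimpleGraph V}
    (hH : G.IsMinimalTriangulation H) {u v : V} (huv : H.Adj u v) (hG : ¬ G.Adj u v) :
    ∃ x y, x ≠ y ∧ ¬ H.Adj x y ∧ H.Adj x u ∧ H.Adj x v ∧ H.Adj y u ∧ H.Adj y v := by
  let H' : SimpleGraph V :=
    { Adj := fun a b => H.Adj a b ∧ ¬ (a = u ∧ b = v) ∧ ¬ (b = u ∧ a = v)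
      symm := ⟨fun a b h => ⟨h.1.symm, h.2.2, h.2.1⟩⟩
      loopless := ⟨fun a h => H.loopless.irrefl a h.1⟩ }
  have hGH' : G ≤ H' := by
    intro a b hab
    refine ⟨hH.prop.1 hab, ?_, ?_⟩
    · rintro ⟨rfl, rfl⟩
      exact hG hab
    · rintro ⟨rfl, rfl⟩
      exact hG hab.symm
  have hH'H : H' ≤ H := fun a b h => h.1
  have hchord : ¬ H'.IsChordal := fun h => (hH.le_of_le ⟨hGH', h⟩ hH'H huv).2.1 ⟨rfl, rfl⟩
  rw [IsChordal] at hchord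
  push Not at hchord
  obtain ⟨m, hm, ⟨f⟩⟩ := hchord
  have hemb : (∀ i j, H.Adj (f i) (f j) → H'.Adj (f i) (f j)) → False := fun h =>
    hH.prop.2 m hm ⟨⟨f.toEmbedding, fun {i j} =>
      ⟨fun h' => f.map_adj_iff.1 (h i j h'), fun h' => hH'H (f.map_adj_iff.2 h')⟩⟩⟩
  obtain ⟨i₀, hi₀⟩ : ∃ i, f i = u := by
    by_contra! hcon
    exact hemb fun i j h => ⟨h, fun h => hcon i h.1, fun h => hcon j h.1⟩
  obtain ⟨j₀, hj₀⟩ : ∃ j, f j = v := by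
    by_contra! hcon
    exact hemb fun i j h => ⟨h, fun h => hcon j h.2, fun h => hcon i h.2⟩
  obtain ⟨g, hg, hg0, hgf⟩ := exists_isInducedCycle hm f i₀
  obtain ⟨j, hjm, hj⟩ := hgf j₀
  rw [hi₀] at hg0
  rw [hj₀] at hj
  have hj0 : 0 < j := by
    rcases Nat.eq_zero_or_pos j with rfl | h
    · exact absurd (hg0.symm.trans hj) huv.ne
    · exact h
  have hnadj : ¬ H'.Adj (g 0) (g j) := fun h => h.2.1 ⟨hg0, hj⟩
  rw [(hg 0 j hj0 hjm).2] at hnadj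
  have hinj : ∀ a b, a < m → b < m → g a = g b → a = b := by
    intro a b ha hb hab
    rcases lt_trichotomy a b with h | h | h
    · exact absurd hab (hg a b h hb).1
    · exact h
    · exact absurd hab.symm (hg b a h ha).1
  have hadj : ∀ a b, a < b → b < m →
      (H.Adj (g a) (g b) ↔ (b = a + 1 ∨ (a = 0 ∧ b + 1 = m)) ∨ (a = 0 ∧ b = j)) := by
    intro a b hab hb
    rw [← (hg a b hab hb).2]
    constructor
    · intro h
      by_cases h' : a = 0 ∧ b = j
      · exact Or.inr h'
      · refine Or.inl ⟨h, fun e => h' ⟨?_, ?_⟩, fun e => ?_⟩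
        · exact hinj _ _ (by omega) (by omega) (e.1.trans hg0.symm)
        · exact hinj _ _ hb hjm (e.2.trans hj.symm)
        · have := hinj _ _ hb (by omega) (e.1.trans hg0.symm)
          omega
    · rintro (h | ⟨rfl, rfl⟩)
      · exact h.1
      · rwa [hg0, hj]
  -- In `H` the cycle has the single chord `uv`, which cuts it into induced cycles of lengths `j +
  -- 1` and `m - j + 1`. Both are triangles.
  have hj2 : j + 1 < 4 := by
    by_contra! h
    refine hH.prop.2.not_isInducedCycle h (g := g) fun a b hab hb => ⟨(hg a b hab ?_).1, ?_⟩
    · omega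
    · rw [hadj a b hab (by omega)]
      omega
  have hmj : m - j + 1 < 4 := by
    by_contra! h
    refine hH.prop.2.not_isInducedCycle h (g := fun i => if i = 0 then g 0 else g (j + i - 1))
      fun a b hab hb => ?_
    have hb0 : b ≠ 0 := by omega
    by_cases ha : a = 0
    · subst ha
      simp only [if_true, hb0, if_false]
      refine ⟨(hg 0 _ (by omega) (by omega)).1, ?_⟩
      rw [hadj _ _ (by omega) (by omega)]
      simp only [true_and]
      omega
    · simp only [ha, hb0, if_false]
      refine ⟨(hg _ _ (by omega) (by omega)).1, ?_⟩
      rw [hadj _ _ (by omega) (by omega)]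
      simp only [false_and, or_false]
      omega
  obtain rfl : j = 2 := by omega
  obtain rfl : m = 4 := by omega
  refine ⟨g 1, g 3, (hg 1 3 (by omega) (by omega)).1, ?_, ?_, ?_, ?_, ?_⟩
  · rw [hadj 1 3 (by omega) (by omega)]
    omega
  · rw [← hg0, adj_comm, hadj 0 1 (by omega) (by omega)]
    omega
  · rw [← hj, hadj 1 2 (by omega) (by omega)]
    omega
  · rw [← hg0, adj_comm, hadj 0 3 (by omega) (by omega)]
    omega
  · rw [← hj, adj_comm, hadj 2 3 (by omega) (by omega)]
    omega

/-- A shortest path in `H[D]` from `d` to the neighbourhood of `w`. -/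
theorem exists_induced_path_to_nbr {H : SimpleGraph V} {D : Set V} {d w : V} (hd : d ∈ D)
    (hconn : ∀ y ∈ D, y ∈ H.compIn D d) (hw : ∃ y ∈ D, H.Adj y w) :
    ∃ (t : ℕ) (p : ℕ → V), p 0 = d ∧ (∀ i, p i ∈ D) ∧ H.Adj (p t) w ∧
      (∀ i < t, ¬ H.Adj (p i) w) ∧
      ∀ i j, i < j → j ≤ t → p i ≠ p j ∧ (H.Adj (p i) (p j) ↔ j = i + 1) := by
  let Γ := H.induce D
  let o : D := ⟨d, hd⟩
  have hreach : ∀ y : D, Γ.Reachable o y := fun y =>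
    ((mem_compIn_iff_reachable hd).1 (hconn y y.2)).2
  obtain ⟨y, hyD, hyw⟩ := hw
  obtain ⟨e, he, hmin⟩ : ∃ e : D, H.Adj e w ∧ ∀ e' : D, H.Adj e' w → Γ.dist o e ≤ Γ.dist o e' := by
    have h : ∃ n, ∃ e : D, H.Adj e w ∧ Γ.dist o e = n := ⟨_, ⟨y, hyD⟩, hyw, rfl⟩
    classical
    obtain ⟨e, he, hn⟩ := Nat.find_spec h
    exact ⟨e, he, fun e' he' => hn ▸ Nat.find_min' h ⟨e', he', rfl⟩⟩
  obtain ⟨q, hq⟩ := (hreach e).exists_walk_length_eq_dist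
  have hdist : ∀ i ≤ q.length, Γ.dist o (q.getVert i) = i := by
    intro i hi
    have h1 := dist_le (q.take i)
    have h2 := dist_le (q.drop i)
    have h3 := (hreach (q.getVert i)).dist_triangle_left e
    rw [Walk.take_length] at h1
    rw [Walk.drop_length] at h2
    omega
  have hadj : ∀ a b : D, Γ.Adj a b → Γ.dist o b ≤ Γ.dist o a + 1 := by
    intro a b hab
    have h := (hreach a).dist_triangle_left b
    rwa [dist_eq_one_iff_adj.2 hab] at h
  refine ⟨q.length, fun i => q.getVert i, by simp [o], fun i => (q.getVert i).2, by simpa using he,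
    fun i hi h => ?_, fun i j hij hj => ⟨fun h => ?_, fun h => ?_, ?_⟩⟩
  · have h1 := hmin _ h
    rw [hdist i hi.le] at h1
    omega
  · have h1 := hdist i (by omega)
    rw [Subtype.ext h, hdist j hj] at h1
    omega
  · have h1 := hadj _ _ (show Γ.Adj (q.getVert i) (q.getVert j) from h)
    rw [hdist i (by omega), hdist j hj] at h1
    omega
  · rintro rfl
    exact q.adj_getVert_succ (by omega)

/-- In a chordal graph, a connected set `D` that sees every vertex of a clique `K` disjoint from
it contains a vertex complete to `K`. -/
theorem IsChordal.exists_complete [Finite V] {H : SimpleGraph V} (hH : H.IsChordal) {D K : Set V}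
    (hK : H.IsClique K) (hDK : ∀ x ∈ D, x ∉ K) (hne : D.Nonempty)
    (hconn : ∀ x ∈ D, ∀ y ∈ D, y ∈ H.compIn D x) (hN : ∀ w ∈ K, ∃ y ∈ D, H.Adj y w) :
    ∃ d ∈ D, ∀ w ∈ K, H.Adj d w := by
  -- Take `d` with maximal neighbourhood in `K`. If it misses `w`, the end `p t` of a shortest path
  -- to the neighbours of `w` sees all that `d` sees, and `w` too.
  obtain ⟨d, hd, hmax⟩ := D.toFinite.exists_maximalFor (fun x => {w | w ∈ K ∧ H.Adj x w}) D hne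
  refine ⟨d, hd, fun w hw => ?_⟩
  by_contra hdw
  obtain ⟨t, p, hp0, hpD, hpt, hpw, hp⟩ :=
    exists_induced_path_to_nbr hd (hconn d hd) (hN w hw)
  have hle : ∀ z ∈ K, H.Adj d z → H.Adj (p t) z := by
    intro z hz hdz
    by_contra hptz
    have hzw : z ≠ w := by
      rintro rfl
      exact hdw hdz
    classical
    let i := Nat.findGreatest (fun i => H.Adj (p i) z) t
    have hi : H.Adj (p i) z :=
      Nat.findGreatest_spec (P := fun i => H.Adj (p i) z) (Nat.zero_le t) (by rwa [hp0])
    have hit : i ≤ t := Nat.findGreatest_le t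
    have hlast : ∀ j, i < j → j ≤ t → ¬ H.Adj (p j) z := fun j h1 h2 =>
      Nat.findGreatest_is_greatest h1 h2
    have hne : i ≠ t := fun e => hptz (e ▸ hi)
    clear_value i
    -- The cycle is `z, p i, …, p t, w`, with `p i` the last neighbour of `z`; `i < t` gives length
    -- at least 4.
    refine hH.not_isInducedCycle (m := t - i + 3) (by omega) (g := fun l =>
      if l = 0 then z else if l ≤ t - i + 1 then p (i + l - 1) else w) fun a b hab hb => ?_
    have hb0 : b ≠ 0 := by omega
    by_cases ha : a = 0
    · subst ha
      by_cases hbt : b ≤ t - i + 1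
      · simp only [if_true, hb0, if_false, hbt]
        refine ⟨fun e => hDK _ (hpD _) (e ▸ hz), fun h => ?_, fun h => ?_⟩
        · by_contra hcon
          exact hlast (i + b - 1) (by omega) (by omega) h.symm
        · obtain rfl : b = 1 := by omega
          simpa using hi.symm
      · simp only [if_true, hb0, if_false, hbt]
        exact ⟨hzw, fun _ => Or.inr ⟨trivial, by omega⟩, fun _ => hK hz hw hzw⟩
    · by_cases hbt : b ≤ t - i + 1
      · have hat : a ≤ t - i + 1 := by omega
        simp only [ha, hb0, if_false, hbt, hat, if_true]
        refine ⟨(hp _ _ (by omega) (by omega)).1, ?_⟩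
        rw [(hp _ _ (by omega) (by omega)).2]
        omega
      · have hat : a ≤ t - i + 1 := by omega
        simp only [ha, hb0, if_false, hbt, hat, if_true]
        refine ⟨fun e => hDK _ (hpD _) (e ▸ hw), fun h => ?_, fun h => ?_⟩
        · by_contra hcon
          exact hpw (i + a - 1) (by omega) h
        · simp only [false_and, or_false] at h
          obtain rfl : a = t - i + 1 := by omega
          rwa [show i + (t - i + 1) - 1 = t by omega]
  exact hdw (hmax (hpD t) (fun z hz => ⟨hz.1, hle z hz.1 hz.2⟩) ⟨hw, hpt⟩).2

/-- A component seeing all of `Ω` would contain a vertex complete to `Ω` in `H`, against maximality.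
For a fill edge `uv`, one of two nonadjacent common neighbours lies outside the clique `Ω`; its
component in `G - Ω` has a clique of `H` as neighbourhood, so by `mem_openNbhd` it sees `u` and `v`
in `G`. -/
theorem IsPotentialMaximalClique.isCliquishIn [Finite V] {G : SimpleGraph V} {Ω : Set V}
    (h : G.IsPotentialMaximalClique Ω) : G.IsCliquishIn Set.univ Ω := by
  obtain ⟨H, hH, hΩ⟩ := h
  have hGH : G ≤ H := hH.prop.1
  refine ⟨Set.subset_univ _, fun x hx => ?_, fun u hu v hv hne huv => ?_⟩
  · by_contra! hcon
    obtain ⟨d, hd, hdΩ⟩ := hH.prop.2.exists_complete hΩ.prop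
      (D := G.compIn (Set.univ \ Ω) x) (fun y hy => (compIn_subset hx hy).2) ⟨x, self_mem_compIn⟩
      (fun y hy z hz => compIn_mono_graph hGH (compIn_connected hy hz))
      (fun w hw => (hcon w hw).imp fun y hy => ⟨hy.1, hGH hy.2⟩)
    have hcl : H.IsClique (insert d Ω) := hΩ.prop.insert fun w hw _ => hdΩ w hw
    exact (compIn_subset hx hd).2 (hΩ.le_of_ge hcl (Set.subset_insert _ _) (Set.mem_insert _ _))
  · have key : ∀ z, z ∉ Ω → H.Adj z u → H.Adj z v → ∃ x ∈ Set.univ \ Ω,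
        (∃ y ∈ G.compIn (Set.univ \ Ω) x, G.Adj y u) ∧
          ∃ y ∈ G.compIn (Set.univ \ Ω) x, G.Adj y v := by
      intro z hz hzu hzv
      have hzU : z ∈ Set.univ \ Ω := ⟨trivial, hz⟩
      have hsub : G.openNbhd (G.compIn (Set.univ \ Ω) z) ⊆ Ω := by
        rintro w ⟨hw, y, hy, hyw⟩
        by_contra hwΩ
        exact hw (mem_compIn_of_adj hy (compIn_subset hzU hy) ⟨trivial, hwΩ⟩ hyw)
      have hmem : ∀ w ∈ Ω, H.Adj z w → w ∈ G.openNbhd (G.compIn (Set.univ \ Ω) z) :=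
        fun w hw hzw => hH.mem_openNbhd (hΩ.prop.subset hsub) self_mem_compIn
          (fun hwc => (compIn_subset hzU hwc).2 hw) hzw
      exact ⟨z, hzU, (hmem u hu hzu).2, (hmem v hv hzv).2⟩
    obtain ⟨x, y, hxy, hnxy, hxu, hxv, hyu, hyv⟩ :=
      hH.exists_common_nbrs (hΩ.prop hu hv hne) huv
    by_cases hx : x ∈ Ω
    · exact key y (fun hy => hnxy (hΩ.prop hx hy hxy)) hyu hyv
    · exact key x hx hxu hxv

end SimpleGraph

/-! ### The two bounds -/

theorem theorem1p3 {V : Type*} [Fintype V] [Nonempty V] (G : SimpleGraph V) (n k : ℕ)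
    (hn : Fintype.card V = n) (hk : G.cliqueNum = k)
    (hP6 : ¬ (SimpleGraph.pathGraph 6).IsIndContained G) :
    {X : Set V | G.IsMinimalSeparator X}.ncard ≤ (2 * n) ^ (k + 1) ∧
    {Ω : Set V | G.IsPotentialMaximalClique Ω}.ncard ≤ 2 ^ (2 * k + 2) * n ^ (2 * k + 3) := by
  have hn1 : 1 ≤ n := hn ▸ Fintype.card_pos
  have hfree : G.CliqueFree (k + 1) := by
    intro s hs
    have := hs.isClique.card_le_cliqueNum
    rw [hs.card_eq, hk] at this
    omega
  have hk1 : 1 ≤ k := by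
    obtain ⟨v⟩ := ‹Nonempty V›
    have := SimpleGraph.IsClique.card_le_cliqueNum (G := G) (t := {v}) (tc := by simp)
    rwa [hk, Finset.card_singleton] at this
  have hsep : ∀ W : Set V, {X | G.IsMinSepIn W X}.ncard ≤ 2 ^ k * n ^ (k + 1) := fun W =>
    hn ▸ SimpleGraph.ncard_isMinSepIn_le hk1 hfree hP6 W
  constructor
  · calc _ ≤ {X | G.IsMinSepIn Set.univ X}.ncard :=
          Set.ncard_le_ncard (fun X hX => SimpleGraph.IsMinimalSeparator.isMinSepIn hX)
            (Set.toFinite _)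
      _ ≤ 2 ^ k * n ^ (k + 1) := hsep _
      _ ≤ 2 ^ (k + 1) * n ^ (k + 1) :=
          Nat.mul_le_mul_right _ (Nat.pow_le_pow_right (by norm_num) (Nat.le_succ k))
      _ = (2 * n) ^ (k + 1) := (mul_pow _ _ _).symm
  · have hs1 : 1 ≤ 2 ^ k * n ^ (k + 1) := Nat.mul_pos (by positivity) (by positivity)
    -- With `s = 2 ^ k * n ^ (k + 1)` the target is `4 * n * s ^ 2`, while `1 + n * (s + s * s)` is
    -- at most `3 * n * s ^ 2`.
    have hexp : 2 ^ (2 * k + 2) * n ^ (2 * k + 3) =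
        4 * n * ((2 ^ k * n ^ (k + 1)) * (2 ^ k * n ^ (k + 1))) := by ring
    have hle := SimpleGraph.ncard_isCliquishIn_le hsep Set.univ
    rw [Set.ncard_univ, Nat.card_eq_fintype_card, hn] at hle
    rw [hexp]
    generalize 2 ^ k * n ^ (k + 1) = s at hs1 hle
    calc _ ≤ {Ω | G.IsCliquishIn Set.univ Ω}.ncard :=
          Set.ncard_le_ncard (fun Ω hΩ => SimpleGraph.IsPotentialMaximalClique.isCliquishIn hΩ)
            (Set.toFinite _)
      _ ≤ 1 + n * (s + s * s) := hle
      _ ≤ 4 * n * (s * s) := by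
          have h1 : s ≤ s * s := Nat.le_mul_of_pos_left s hs1
          have h2 : 1 ≤ n * (s * s) := Nat.mul_pos hn1 (Nat.mul_pos hs1 hs1)
          have h3 : n * s ≤ n * (s * s) := Nat.mul_le_mul_left n h1
          nlinarith
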